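/- Let $R$ be a commutative ring in which $2$ is invertible, let $M$ be a finitely generated projective $R$-module and let $q : M \to R$ be a quadratic form. Let $\operatorname{Sper} R$ denote the real spectrum of $R$, i.e. the set of all orderings of $R$: subsets $\alpha \subseteq R$ with $\alpha + \alpha \subseteq \alpha$, $\alpha\cdot\alpha \subseteq \alpha$, $\alpha \cup -\alpha = R$ and $\operatorname{Supp}(\alpha) := \alpha \cap -\alpha$ a prime ideal of $R$. For $\alpha \in \operatorname{Sper} R$ let $\kappa(\alpha)$ be the field of fractions of $R/\operatorname{Supp}(\alpha)$, with the ordering $\bar\alpha$ induced by $\alpha$, and let $\operatorname{sign}_\alpha q \in \mathbb{Z}$ be the signature at $\bar\alpha$ of the quadratic form $q \otimes_R \kappa(\alpha)$ (the number of positive minus the number of negative entries in any diagonalization; $q$ may be singular). The Harrison topology on $\operatorname{Sper} R$ has the sets $\mathring H(r) = \{\alpha \in \operatorname{Sper} R \mid r \in \alpha \setminus -\alpha\}$, $r \in R$, as a subbasis of open sets, and the constructible topology has the finite boolean combinations of the sets $\mathring H(r)$ as a basis of open sets. Equip $\mathbb{Z}$ with the discrete topology. Then: 1. The total signature map $\operatorname{sign}_\bullet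 q : \operatorname{Sper} R \to \mathbb{Z}$, $\alpha \mapsto \operatorname{sign}_\alpha q$, is continuous for the constructible topology on $\operatorname{Sper} R$. 2. If $q$ is nonsingular (i.e. its associated symmetric bilinear form induces an isomorphism $M \to \operatorname{Hom}_R(M,R)$), then $\operatorname{sign}_\bullet q$ is also continuous for the Harrison topology on $\operatorname{Sper} R$. -/

import Mathlib

open scoped Topology

/-- A point of the real spectrum `Sper R` of a commutative ring `R`: an ordering of `R`, i.e. a
subset `P ⊆ R` with `P + P ⊆ P`, `P * P ⊆ P`, `P ∪ -P = R` and `P ∩ -P` a prime ideal. -/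
structure RealSpectrum (R : Type*) [CommRing R] where
  toRingPreordering : RingPreordering R
  isOrdering : toRingPreordering.IsOrdering

namespace RealSpectrum

instance instSetLike (R : Type*) [CommRing R] : SetLike (RealSpectrum R) R where
  coe α := α.toRingPreordering
  coe_injective := by
    rintro ⟨P, hP⟩ ⟨Q, hQ⟩ h
    obtain rfl : P = Q := SetLike.coe_injective h
    rfl

instance instSubsemiringClass (R : Type*) [CommRing R] :
    SubsemiringClass (RealSpectrum R) R where
  zero_mem α := zero_mem α.toRingPreordering
  one_mem α := one_mem α.toRingPreordering
  add_mem {α} _ _ ha hb := α.toRingPreordering.toSubsemiring.add_mem ha hb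
  mul_mem {α} _ _ ha hb := α.toRingPreordering.toSubsemiring.mul_mem ha hb

instance instIsOrdering {R : Type*} [CommRing R] (α : RealSpectrum R) :
    α.toRingPreordering.IsOrdering :=
  α.isOrdering

/-- The support `α ∩ -α` of a point `α` of the real spectrum, a prime ideal of `R`. -/
abbrev supp {R : Type*} [CommRing R] (α : RealSpectrum R) : Ideal R :=
  α.toRingPreordering.support

theorem mem_supp {R : Type*} [CommRing R] {α : RealSpectrum R} {r : R} :
    r ∈ α.supp ↔ r ∈ α ∧ -r ∈ α :=
  Iff.rfl

/-- The Harrison set of `r`: all `α` with `r > 0` at `α`, i.e. `r ∈ α \ -α`. -/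
def harrisonSet {R : Type*} [CommRing R] (r : R) : Set (RealSpectrum R) :=
  {α | r ∈ α ∧ -r ∉ α}

/-- The Harrison topology on `Sper R`, with the Harrison sets as a subbasis of open sets. -/
@[reducible] def harrisonTopology (R : Type*) [CommRing R] : TopologicalSpace (RealSpectrum R) :=
  TopologicalSpace.generateFrom (Set.range harrisonSet)

/-- The constructible topology on `Sper R`, generated by the finite boolean combinations of
Harrison sets (these are closed under finite intersections, so they form a basis). -/
@[reducible] def constructibleTopology (R : Type*) [CommRing R] : TopologicalSpace (RealSpectrum R) :=
  TopologicalSpace.generateFrom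
    (BooleanSubalgebra.closure (Set.range (harrisonSet (R := R))) : Set (Set (RealSpectrum R)))

/-- The residue field `κ(α)`: the field of fractions of `R / supp α`. -/
abbrev residueField {R : Type*} [CommRing R] (α : RealSpectrum R) : Type _ :=
  α.supp.ResidueField

theorem mem_or_neg_mem' {R : Type*} [CommRing R] (α : RealSpectrum R) (r : R) :
    r ∈ α ∨ -r ∈ α :=
  mem_or_neg_mem α.toRingPreordering r

theorem sq_mem {R : Type*} [CommRing R] (α : RealSpectrum R) (r : R) : r * r ∈ α :=
  α.toRingPreordering.mul_self_mem r

theorem map_ne_zero {R : Type*} [CommRing R] {α : RealSpectrum R} {r : R} (hr : r ∉ α.supp) :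
    algebraMap R α.residueField r ≠ 0 :=
  fun h => hr (Ideal.algebraMap_residueField_eq_zero.1 h)

/-- Membership in `α` depends only on the class modulo the support. -/
theorem mem_of_sub_mem_supp {R : Type*} [CommRing R] {α : RealSpectrum R} {a b : R}
    (h : a - b ∈ α.supp) (hb : b ∈ α) : a ∈ α := by
  simpa using add_mem (mem_supp.1 h).1 hb

/-- One may cancel a positive factor. -/
theorem mem_of_mul_mem {R : Type*} [CommRing R] {α : RealSpectrum R} {a b : R}
    (hb : b ∈ α) (hb' : b ∉ α.supp) (h : a * b ∈ α) : a ∈ α := by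
  rcases α.mem_or_neg_mem' a with ha | ha
  · exact ha
  · have h1 : a * b ∈ α.supp := mem_supp.2 ⟨h, by simpa using mul_mem ha hb⟩
    rcases Ideal.IsPrime.mem_or_mem inferInstance h1 with h2 | h2
    · exact (mem_supp.1 h2).1
    · exact absurd h2 hb'

theorem exists_eq_div {R : Type*} [CommRing R] (α : RealSpectrum R) (x : α.residueField) :
    ∃ a b : R, b ∈ α ∧ b ∉ α.supp ∧
      x = algebraMap R α.residueField a / algebraMap R α.residueField b := by
  obtain ⟨a, b, hb, rfl⟩ := IsFractionRing.div_surjective (A := R ⧸ α.supp) x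
  obtain ⟨a, rfl⟩ := Ideal.Quotient.mk_surjective a
  obtain ⟨b, rfl⟩ := Ideal.Quotient.mk_surjective b
  have hb' : b ∉ α.supp := fun h =>
    nonZeroDivisors.ne_zero hb (Ideal.Quotient.eq_zero_iff_mem.2 h)
  have hbb : b * b ∉ α.supp := fun h => hb' (by
    rcases Ideal.IsPrime.mem_or_mem inferInstance h with h | h <;> exact h)
  refine ⟨a * b, b * b, α.sq_mem b, hbb, ?_⟩
  have := map_ne_zero hb'
  simp only [map_mul, Ideal.algebraMap_quotient_residueField_mk]
  field_simp

/-- The ordering `ᾱ` induced by `α` on `κ(α)`, given by its set of nonnegative elements: the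
quotients `a / b` of elements of `α` with `b` not in the support. -/
def residueCone {R : Type*} [CommRing R] (α : RealSpectrum R) : RingCone α.residueField where
  carrier := {x | ∃ a b : R, a ∈ α ∧ b ∈ α ∧ b ∉ α.supp ∧
    x = algebraMap R α.residueField a / algebraMap R α.residueField b}
  zero_mem' := ⟨0, 1, zero_mem α, one_mem α,
    (Ideal.ne_top_iff_one _).1 (Ideal.IsPrime.ne_top inferInstance), by simp⟩
  one_mem' := ⟨1, 1, one_mem α, one_mem α,
    (Ideal.ne_top_iff_one _).1 (Ideal.IsPrime.ne_top inferInstance), by simp⟩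
  add_mem' := by
    rintro _ _ ⟨a, b, ha, hb, hb', rfl⟩ ⟨c, d, hc, hd, hd', rfl⟩
    refine ⟨a * d + c * b, b * d, add_mem (mul_mem ha hd) (mul_mem hc hb), mul_mem hb hd,
      fun h => (Ideal.IsPrime.mem_or_mem inferInstance h).elim hb' hd', ?_⟩
    have := map_ne_zero hb'
    have := map_ne_zero hd'
    simp only [map_mul, map_add]
    field_simp
  mul_mem' := by
    rintro _ _ ⟨a, b, ha, hb, hb', rfl⟩ ⟨c, d, hc, hd, hd', rfl⟩
    refine ⟨a * c, b * d, mul_mem ha hc, mul_mem hb hd,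
      fun h => (Ideal.IsPrime.mem_or_mem inferInstance h).elim hb' hd', ?_⟩
    simp only [map_mul, div_mul_div_comm]
  eq_zero_of_mem_of_neg_mem' := by
    rintro _ ⟨a, b, ha, hb, hb', rfl⟩ ⟨c, d, hc, hd, hd', h⟩
    have h1 := map_ne_zero hb'
    have h2 := map_ne_zero hd'
    have h3 : algebraMap R α.residueField (-(a * d) - c * b) = 0 := by
      simp only [map_mul, map_sub, map_neg]
      field_simp at h
      linear_combination h
    have h4 : -(a * d) ∈ α :=
      mem_of_sub_mem_supp (Ideal.algebraMap_residueField_eq_zero.1 h3) (mul_mem hc hb)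
    have h5 : -a ∈ α := mem_of_mul_mem hd hd' (by simpa using h4)
    have h6 : algebraMap R α.residueField a = 0 :=
      Ideal.algebraMap_residueField_eq_zero.2 (mem_supp.2 ⟨ha, h5⟩)
    simp [h6]

instance hasMemOrNegMem_residueCone {R : Type*} [CommRing R] (α : RealSpectrum R) :
    HasMemOrNegMem α.residueCone where
  mem_or_neg_mem x := by
    obtain ⟨a, b, hb, hb', rfl⟩ := α.exists_eq_div x
    rcases α.mem_or_neg_mem' a with ha | ha
    · exact Or.inl ⟨a, b, ha, hb, hb', rfl⟩
    · exact Or.inr ⟨-a, b, ha, hb, hb', by simp [neg_div]⟩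

open Classical in
/-- The linear order on `κ(α)` whose nonnegative elements are those of `ᾱ`. -/
@[reducible] noncomputable def residueOrder {R : Type*} [CommRing R] (α : RealSpectrum R) :
    LinearOrder α.residueField :=
  LinearOrder.mkOfAddGroupCone α.residueCone

theorem isStrictOrderedRing_residueField {R : Type*} [CommRing R] (α : RealSpectrum R) :
    letI := α.residueOrder
    IsStrictOrderedRing α.residueField := by
  let _ := α.residueOrder
  have : IsOrderedRing α.residueField := IsOrderedRing.mkOfCone α.residueCone
  exact IsOrderedRing.toIsStrictOrderedRing α.residueField

theorem residueOrder_le_iff {R : Type*} [CommRing R] (α : RealSpectrum R)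
    (x y : α.residueField) : α.residueOrder.le x y ↔ y - x ∈ α.residueCone :=
  Iff.rfl

/-- The ordering of `κ(α)` restricts to `α` along `R → κ(α)`. -/
theorem map_mem_residueCone_iff {R : Type*} [CommRing R] (α : RealSpectrum R) (r : R) :
    algebraMap R α.residueField r ∈ α.residueCone ↔ r ∈ α := by
  constructor
  · rintro ⟨a, b, ha, hb, hb', h⟩
    have h1 := map_ne_zero hb'
    have h3 : algebraMap R α.residueField (r * b - a) = 0 := by
      simp only [map_mul, map_sub]
      field_simp at h
      linear_combination h
    exact mem_of_mul_mem hb hb'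
      (mem_of_sub_mem_supp (Ideal.algebraMap_residueField_eq_zero.1 h3) ha)
  · intro hr
    exact ⟨r, 1, hr, one_mem α,
      (Ideal.ne_top_iff_one _).1 (Ideal.IsPrime.ne_top inferInstance), by simp⟩

end RealSpectrum

/-- The signature of a quadratic form over a linearly ordered field `K`: the number of positive
minus the number of negative entries in any diagonalization, where these numbers are the maximal
dimensions of positive definite and of negative definite subspaces. -/
noncomputable def QuadraticForm.fieldSignature {K V : Type*} [Field K] [LinearOrder K]
    [AddCommGroup V] [Module K V] (q : QuadraticForm K V) : ℤ :=
  (sigPos q : ℤ) - (sigNeg q : ℤ)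

/-- The signature of a quadratic form `q` over `R` at `α ∈ Sper R`: the signature of
`q ⊗ κ(α)` with respect to the ordering `ᾱ` of `κ(α)` induced by `α`. -/
noncomputable def QuadraticForm.signAt {R M : Type*} [CommRing R] [Invertible (2 : R)]
    [AddCommGroup M] [Module R M] (q : QuadraticForm R M) (α : RealSpectrum R) : ℤ :=
  letI := α.residueOrder
  (QuadraticForm.baseChange α.residueField q).fieldSignature

/-- A quadratic form `q` on `M` is nonsingular if its associated symmetric bilinear form
(`b` with `b x x = q x`) is a perfect pairing, i.e. induces an isomorphism from `M` to its dual. -/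
def QuadraticForm.IsNonsingular {R M : Type*} [CommRing R] [Invertible (2 : R)]
    [AddCommGroup M] [Module R M] (q : QuadraticForm R M) : Prop :=
  (QuadraticMap.associated q : M →ₗ[R] M →ₗ[R] R).IsPerfPair

/-!
Write `b` for the symmetric bilinear form of `q` and `q_α` for the form `q ⊗ κ(α)`. Clearing
denominators in an orthogonal basis of `q_α` gives `m₁, …, mₙ` in `M` whose images `1 ⊗ mᵢ` form a
basis of `κ(α) ⊗ M` and which satisfy `b(mᵢ, mⱼ) ∈ supp α` for `i ≠ j`; the signature of `q` at `α`
is then read off from the signs at `α` of the values `q(mᵢ)`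
(`QuadraticForm.exists_basis_one_tmul_orthogonal`, `RealSpectrum.sigPos_fiberForm_eq_ncard`).

*Constructible topology.* The sign conditions on `q(mᵢ)`, including `q(mᵢ) = 0`, and the equations
`b(mᵢ, mⱼ) = 0` define a constructible neighbourhood of `α`. By Nakayama's lemma the `1 ⊗ mᵢ` still
span in a Zariski neighbourhood, and the rank of `M` is locally constant, so near `α` they remain a
basis. Hence they diagonalize `q_β` with the same signs for all `β` near `α`.

*Harrison topology.* The equations `b(mᵢ, mⱼ) = 0` are no longer open conditions, but those `mᵢ` with
`q(mᵢ) > 0` at `α` satisfy there, for `i ≠ j`, the strict inequalities `k |b(mᵢ, mⱼ)| < q(mᵢ)`,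
with `k` the number of these `mᵢ`. All these inequalities persist near `α`, and diagonal dominance makes
`q_β` positive definite on a subspace of dimension `k`
(`QuadraticForm.card_le_sigPos_of_diagonally_dominant`). So the positive index is lower
semicontinuous, and so is the negative index, applying this to `-q`. If `q` is nonsingular, the radical
of every `q_β` vanishes (`QuadraticForm.IsNonsingular.radical_baseChange`), so the two indices add
up to the locally constant rank of `M`; hence both are locally constant.
-/

open scoped TensorProduct

/-! ### Quadratic forms over ordered fields and base change -/

namespace QuadraticForm

/-- A quadratic form whose Gram matrix on a finite family is diagonally dominant with positive
diagonal is positive definite on the span of that family, which has full dimension. -/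
theorem card_le_sigPos_of_diagonally_dominant {K V ι : Type*} [Field K] [LinearOrder K]
    [IsStrictOrderedRing K] [Invertible (2 : K)] [AddCommGroup V] [Module K V]
    [FiniteDimensional K V] [Fintype ι] (Q : QuadraticForm K V) (v : ι → V)
    (hpos : ∀ i, 0 < Q (v i))
    (hdom : ∀ i j, i ≠ j →
      Fintype.card ι * |QuadraticMap.associated (R := K) Q (v i) (v j)| < Q (v i)) :
    Fintype.card ι ≤ sigPos Q := by
  classical
  set B := QuadraticMap.associated (R := K) Q with hB
  have hsymm : ∀ x y, B x y = B y x := fun x y =>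
    QuadraticMap.associated_isSymm K Q x y
  have hself : ∀ x, B x x = Q x := fun x => QuadraticMap.associated_eq_self_apply K Q x
  have key : ∀ x : ι → K, x ≠ 0 → 0 < Q (∑ i, x i • v i) := by
    intro x hx
    set c : K := (Fintype.card ι : K) with hc
    set S : K := ∑ i, x i ^ 2 * Q (v i) with hS
    have hSpos : 0 < S := by
      obtain ⟨i, hi⟩ := Function.ne_iff.1 hx
      refine Finset.sum_pos' (fun j _ => mul_nonneg (sq_nonneg _) (hpos j).le)
        ⟨i, Finset.mem_univ i, mul_pos ((sq_pos_iff (a := x i)).2 hi) (hpos i)⟩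
    have hQ : Q (∑ i, x i • v i) = ∑ i, ∑ j, x i * x j * B (v i) (v j) := by
      rw [← hself]
      simp only [map_sum, LinearMap.sum_apply, map_smul, LinearMap.smul_apply, smul_eq_mul,
        mul_assoc]
      refine Finset.sum_congr rfl fun i _ => ?_
      rw [Finset.mul_sum]
      exact Finset.sum_congr rfl fun j _ => by rw [hsymm]
    -- Summed over all `i` and `j`, these bounds give `(c + 1) * S ≤ c * Q (∑ i, x i • v i) + c * S`.
    have hterm : ∀ i j, (if i = j then (c + 1) * (x i ^ 2 * Q (v i)) else 0) ≤
        c * (x i * x j * B (v i) (v j)) + (x i ^ 2 * Q (v i) + x j ^ 2 * Q (v j)) / 2 := by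
      intro i j
      split_ifs with h
      · subst h
        rw [hself]
        exact le_of_eq (by ring)
      · have h1 := hdom i j h
        have h2 := hdom j i (Ne.symm h)
        rw [hsymm] at h2
        have hc0 : 0 ≤ c := Nat.cast_nonneg _
        rw [← abs_of_nonneg hc0, ← abs_mul, abs_lt] at h1 h2
        rcases le_total 0 (c * B (v i) (v j)) with hw | hw
        · nlinarith [mul_nonneg hw (sq_nonneg (x i + x j)), mul_nonneg (sq_nonneg (x i))
            (sub_nonneg.2 h1.2.le), mul_nonneg (sq_nonneg (x j)) (sub_nonneg.2 h2.2.le)]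
        · nlinarith [mul_nonneg (neg_nonneg.2 hw) (sq_nonneg (x i - x j)), mul_nonneg
            (sq_nonneg (x i)) (sub_nonneg.2 h1.1.le), mul_nonneg (sq_nonneg (x j))
            (sub_nonneg.2 h2.1.le)]
    have hsum := Finset.sum_le_sum fun i (_ : i ∈ Finset.univ) =>
      Finset.sum_le_sum fun j (_ : j ∈ Finset.univ) => hterm i j
    simp only [Finset.sum_ite_eq, Finset.mem_univ, if_true, Finset.sum_add_distrib,
      ← Finset.mul_sum, ← Finset.sum_div, Finset.sum_const, Finset.card_univ, nsmul_eq_mul,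
      ← hQ, ← hS, ← hc] at hsum
    have hcpos : 0 < c := by
      obtain ⟨i, -⟩ := Function.ne_iff.1 hx
      exact Nat.cast_pos.2 (Fintype.card_pos_iff.2 ⟨i⟩)
    have hS' : ∑ j, x j ^ 2 * (c * Q (v j)) = c * S := by
      rw [hS, Finset.mul_sum]
      exact Finset.sum_congr rfl fun j _ => by ring
    rw [hS'] at hsum
    have : 0 < c * Q (∑ i, x i • v i) := by linarith
    exact pos_of_mul_pos_right this hcpos.le
  have hli : LinearIndependent K v := by
    rw [Fintype.linearIndependent_iff]
    intro g hg
    by_contra! h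
    have := key g (fun h0 => by simp [h0] at h)
    simp [hg] at this
  rw [← finrank_span_eq_card hli]
  refine le_sigPos_of_posDef Q ?_
  rintro ⟨y, hy⟩ hy0
  obtain ⟨x, rfl⟩ := (Submodule.mem_span_range_iff_exists_fun K).1 hy
  exact key x fun hx => hy0 (by simp [hx])

theorem baseChange_neg {R M : Type*} (A : Type*) [CommRing R] [CommRing A] [Algebra R A]
    [Invertible (2 : R)] [AddCommGroup M] [Module R M] (q : QuadraticForm R M) :
    QuadraticForm.baseChange A (-q) = -QuadraticForm.baseChange A q := by
  refine baseChange_ext fun m => ?_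
  simp

theorem associated_baseChange_tmul {R M : Type*} (A : Type*) [CommRing R] [CommRing A]
    [Algebra R A] [Invertible (2 : R)] [Invertible (2 : A)] [AddCommGroup M] [Module R M]
    (q : QuadraticForm R M) (a b : A) (m n : M) :
    QuadraticMap.associated (R := A) (q.baseChange A) (a ⊗ₜ m) (b ⊗ₜ n) =
      (QuadraticMap.associated (R := R) q m n) • (a * b) := by
  rw [QuadraticForm.associated_baseChange, LinearMap.BilinForm.baseChange_tmul, mul_comm]

/-- A dual basis of `M`, transported to `M` along the isomorphism given by `q`, recovers every
vector of `A ⊗ M` from its products under the base-changed form; so the radical vanishes. -/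
theorem IsNonsingular.radical_baseChange {R M : Type*} (A : Type*) [CommRing R] [CommRing A]
    [Algebra R A] [Invertible (2 : R)] [AddCommGroup M] [Module R M] [Module.Finite R M]
    [Module.Projective R M] {q : QuadraticForm R M} (hq : q.IsNonsingular) :
    (q.baseChange A).radical = ⊥ := by
  let _ : Invertible (2 : A) := (Invertible.map (algebraMap R A) 2).copy 2 (map_ofNat _ _).symm
  -- The coordinates of `g` and the images under `f` of the unit vectors form a dual basis of `M`;
  -- `d k` represents the `k`-th coordinate with respect to the bilinear form of `q`.
  obtain ⟨n, f, g, -, -, hfg⟩ := Module.Finite.exists_comp_eq_id_of_projective R M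
  choose d hd using fun k : Fin n => hq.bijective_left.surjective (LinearMap.proj k ∘ₗ g)
  have hdual : ∀ x : A ⊗[R] M, x = ∑ k, QuadraticMap.associated (R := A) (q.baseChange A)
      x (1 ⊗ₜ d k) • (1 : A) ⊗ₜ[R] f (Pi.single k 1) := by
    intro x
    induction x with
    | zero => simp
    | add x y hx hy =>
      conv_lhs => rw [hx, hy]
      simp [add_smul, Finset.sum_add_distrib]
    | tmul a m =>
      have hm : m = ∑ k, QuadraticMap.associated (R := R) q m (d k) • f (Pi.single k 1) := by
        have h1 : ∀ k, QuadraticMap.associated (R := R) q m (d k) = g m k := fun k => by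
          rw [QuadraticMap.associated_isSymm R q m (d k), hd]
          simp
        simp only [h1, ← map_smul, ← map_sum]
        conv_lhs => rw [← LinearMap.id_apply (R := R) m, ← hfg]
        simp only [LinearMap.comp_apply]
        congr 1
        exact pi_eq_sum_univ' (g m)
      conv_lhs => rw [hm]
      simp [associated_baseChange_tmul, TensorProduct.tmul_sum, TensorProduct.smul_tmul']
  rw [QuadraticMap.radical_eq_ker_associated, Submodule.eq_bot_iff]
  intro x hx
  rw [LinearMap.mem_ker] at hx
  rw [hdual x]
  simp [hx]

theorem exists_associated_orthogonal_basis {K V : Type*} [Field K] [Invertible (2 : K)]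
    [AddCommGroup V] [Module K V] [FiniteDimensional K V] (Q : QuadraticForm K V) :
    ∃ v : Module.Basis (Fin (Module.finrank K V)) K V,
      (QuadraticMap.associated (R := K) Q).IsOrthoᵢ v :=
  LinearMap.BilinForm.exists_orthogonal_basis ⟨QuadraticMap.associated_isSymm K Q⟩

theorem equivalent_weightedSumSquares_of_basis {K V ι : Type*} [Field K] [Invertible (2 : K)]
    [AddCommGroup V] [Module K V] [Fintype ι] (Q : QuadraticForm K V) (v : Module.Basis ι K V)
    (hv : (QuadraticMap.associated (R := K) Q).IsOrthoᵢ v) :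
    QuadraticMap.Equivalent Q (QuadraticMap.weightedSumSquares K fun i => Q (v i)) := by
  rw [← QuadraticMap.basisRepr_eq_of_iIsOrtho Q v hv]
  exact ⟨Q.isometryEquivBasisRepr v⟩

end QuadraticForm

/-! ### Fibers of a module over the prime spectrum -/

/-- Denominators can be cleared in the fiber of a module at a prime ideal. -/
theorem Ideal.ResidueField.exists_smul_eq_one_tmul {R M : Type*} [CommRing R] [AddCommGroup M]
    [Module R M] (p : Ideal R) [p.IsPrime] (x : p.ResidueField ⊗[R] M) :
    ∃ r ∉ p, ∃ m : M, r • x = 1 ⊗ₜ[R] m := by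
  induction x with
  | zero => exact ⟨1, p.one_notMem, 0, by simp⟩
  | tmul a m =>
    obtain ⟨b, c, hc, rfl⟩ := IsFractionRing.div_surjective (A := R ⧸ p) a
    obtain ⟨b, rfl⟩ := Ideal.Quotient.mk_surjective b
    obtain ⟨c, rfl⟩ := Ideal.Quotient.mk_surjective c
    have hc' : c ∉ p := fun h =>
      nonZeroDivisors.ne_zero hc (Ideal.Quotient.eq_zero_iff_mem.2 h)
    have hc0 : algebraMap R p.ResidueField c ≠ 0 := fun h =>
      hc' (Ideal.algebraMap_residueField_eq_zero.1 h)
    refine ⟨c, hc', b • m, ?_⟩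
    rw [TensorProduct.smul_tmul', ← TensorProduct.smul_tmul]
    rw [Ideal.algebraMap_quotient_residueField_mk, Ideal.algebraMap_quotient_residueField_mk,
      Algebra.smul_def, Algebra.smul_def, mul_one, mul_div_cancel₀ _ hc0]
  | add x y hx hy =>
    obtain ⟨r, hr, m, hm⟩ := hx
    obtain ⟨s, hs, n, hn⟩ := hy
    refine ⟨r * s, fun h => (Ideal.IsPrime.mem_or_mem inferInstance h).elim hr hs,
      s • m + r • n, ?_⟩
    rw [smul_add, mul_comm, mul_smul, hm, mul_comm, mul_smul, hn, TensorProduct.tmul_add,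
      TensorProduct.tmul_smul, TensorProduct.tmul_smul]

/-- By Nakayama's lemma the locus where `m` spans the fiber of `M` is the complement of the support
of the quotient of `M` by the span of `m`, and that support is closed. -/
theorem PrimeSpectrum.isOpen_span_one_tmul_eq_top {R M ι : Type*} [CommRing R] [AddCommGroup M]
    [Module R M] [Module.Finite R M] (m : ι → M) :
    IsOpen {p : PrimeSpectrum R | Submodule.span p.asIdeal.ResidueField
      (Set.range fun i => (1 : p.asIdeal.ResidueField) ⊗ₜ[R] m i) = ⊤} := by
  set N := Submodule.span R (Set.range m) with hN
  have h : {p : PrimeSpectrum R | Submodule.span p.asIdeal.ResidueField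
      (Set.range fun i => (1 : p.asIdeal.ResidueField) ⊗ₜ[R] m i) = ⊤} =
      (Module.support R (M ⧸ N))ᶜ := by
    ext p
    set K := p.asIdeal.ResidueField
    rw [Set.mem_compl_iff, Module.mem_support_iff_nontrivial_residueField_tensorProduct,
      not_nontrivial_iff_subsingleton, Set.mem_ofPred_eq]
    have hspan : Submodule.span K (Set.range fun i => (1 : K) ⊗ₜ[R] m i) =
        LinearMap.range (N.subtype.baseChange K) := by
      change _ = N.baseChange K
      rw [hN, Submodule.baseChange_span, ← Set.range_comp]
      rfl
    have hexact : Function.Exact (N.subtype.baseChange K) (N.mkQ.baseChange K) :=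
      lTensor_exact K (LinearMap.exact_subtype_mkQ N) N.mkQ_surjective
    have hsurj : Function.Surjective (N.mkQ.baseChange K) :=
      LinearMap.lTensor_surjective K N.mkQ_surjective
    rw [hspan, ← (LinearMap.exact_iff.1 hexact), LinearMap.ker_eq_top]
    constructor
    · intro h0
      refine ⟨fun a b => ?_⟩
      obtain ⟨a, rfl⟩ := hsurj a
      obtain ⟨b, rfl⟩ := hsurj b
      simp [h0]
    · intro h0
      ext
      exact Subsingleton.elim _ _
  rw [h]
  exact Module.isClosed_support.isOpen_compl

/-- Each fiber of a quadratic form is diagonalized by a basis that comes from elements of the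
module. -/
theorem QuadraticForm.exists_basis_one_tmul_orthogonal {R M : Type*} [CommRing R]
    [Invertible (2 : R)] [AddCommGroup M] [Module R M] [Module.Finite R M]
    (q : QuadraticForm R M) (p : Ideal R) [p.IsPrime] :
    ∃ (m : Fin (Module.finrank p.ResidueField (p.ResidueField ⊗[R] M)) → M)
      (v : Module.Basis (Fin (Module.finrank p.ResidueField (p.ResidueField ⊗[R] M)))
        p.ResidueField (p.ResidueField ⊗[R] M)),
      (∀ i, v i = 1 ⊗ₜ m i) ∧
        ∀ i j, i ≠ j → QuadraticMap.associated (R := R) q (m i) (m j) ∈ p := by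
  let _ : Invertible (2 : p.ResidueField) :=
    (Invertible.map (algebraMap R p.ResidueField) 2).copy 2 (map_ofNat _ _).symm
  obtain ⟨w, hw⟩ := (q.baseChange p.ResidueField).exists_associated_orthogonal_basis
  choose r hr m hm using fun i => Ideal.ResidueField.exists_smul_eq_one_tmul p (w i)
  have hr0 : ∀ i, algebraMap R p.ResidueField (r i) ≠ 0 := fun i h =>
    hr i (Ideal.algebraMap_residueField_eq_zero.1 h)
  have hm' : ∀ i, algebraMap R p.ResidueField (r i) • w i = 1 ⊗ₜ m i := fun i => by
    rw [algebraMap_smul p.ResidueField (r i) (w i), hm]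
  refine ⟨m, w.unitsSMul fun i => Units.mk0 _ (hr0 i), fun i => ?_, fun i j hij => ?_⟩
  · rw [Module.Basis.unitsSMul_apply, ← hm', Units.smul_def, Units.val_mk0]
  · have h := QuadraticForm.associated_baseChange_tmul p.ResidueField q 1 1 (m i) (m j)
    have h0 : QuadraticMap.associated (R := p.ResidueField) (q.baseChange p.ResidueField)
      (w i) (w j) = 0 := hw hij
    rw [← hm', ← hm', map_smul, LinearMap.map_smul₂, h0, smul_zero, smul_zero, mul_one,
      Algebra.smul_def, mul_one] at h
    exact Ideal.algebraMap_residueField_eq_zero.1 h.symm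

/-! ### The real spectrum and its topologies -/

namespace RealSpectrum

variable {R : Type*} [CommRing R]

attribute [local instance] residueOrder

attribute [local instance] isStrictOrderedRing_residueField

theorem algebraMap_pos_iff (α : RealSpectrum R) (r : R) :
    0 < algebraMap R α.residueField r ↔ α ∈ harrisonSet r := by
  rw [lt_iff_not_ge, residueOrder_le_iff, zero_sub, ← map_neg, map_mem_residueCone_iff]
  refine ⟨fun h => ⟨(α.mem_or_neg_mem' r).resolve_right h, h⟩, fun h => h.2⟩

theorem algebraMap_eq_zero_iff (α : RealSpectrum R) (r : R) :
    algebraMap R α.residueField r = 0 ↔ α ∉ harrisonSet r ∧ α ∉ harrisonSet (-r) := by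
  rw [← algebraMap_pos_iff, ← algebraMap_pos_iff, map_neg, neg_pos, not_lt, not_lt, and_comm,
    ← le_antisymm_iff, eq_comm]

/-- The support map from the real spectrum to the prime spectrum. -/
def toPrimeSpectrum (α : RealSpectrum R) : PrimeSpectrum R := ⟨α.supp, inferInstance⟩

theorem isOpen_harrisonSet (r : R) : IsOpen[harrisonTopology R] (harrisonSet r) :=
  TopologicalSpace.isOpen_generateFrom_of_mem ⟨r, rfl⟩

theorem constructibleTopology_le_harrisonTopology :
    constructibleTopology R ≤ harrisonTopology R :=
  TopologicalSpace.generateFrom_anti BooleanSubalgebra.subset_closure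

theorem isOpen_constructibleTopology_compl_harrisonSet (r : R) :
    IsOpen[constructibleTopology R] (harrisonSet r)ᶜ :=
  TopologicalSpace.isOpen_generateFrom_of_mem
    (BooleanSubalgebra.compl_mem (BooleanSubalgebra.subset_closure ⟨r, rfl⟩))

theorem continuous_toPrimeSpectrum :
    Continuous[harrisonTopology R, PrimeSpectrum.zariskiTopology]
      (toPrimeSpectrum : RealSpectrum R → PrimeSpectrum R) := by
  let _ := harrisonTopology R
  rw [PrimeSpectrum.isTopologicalBasis_basic_opens.continuous_iff]
  rintro _ ⟨r, rfl⟩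
  -- An element lies outside the support exactly if it is positive or negative.
  have h : toPrimeSpectrum ⁻¹' (PrimeSpectrum.basicOpen r : Set (PrimeSpectrum R)) =
      harrisonSet r ∪ harrisonSet (-r) := by
    ext α
    have := algebraMap_eq_zero_iff α r
    rw [Ideal.algebraMap_residueField_eq_zero] at this
    simp only [toPrimeSpectrum, Set.mem_preimage, SetLike.mem_coe, PrimeSpectrum.mem_basicOpen,
      Set.mem_union]
    tauto
  rw [h]
  exact (isOpen_harrisonSet r).union (isOpen_harrisonSet (-r))

theorem isOpen_span_one_tmul_eq_top {M ι : Type*} [AddCommGroup M] [Module R M]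
    [Module.Finite R M] (m : ι → M) :
    IsOpen[harrisonTopology R] {α : RealSpectrum R | Submodule.span α.residueField
      (Set.range fun i => (1 : α.residueField) ⊗ₜ[R] m i) = ⊤} := by
  let _ := harrisonTopology R
  exact (PrimeSpectrum.isOpen_span_one_tmul_eq_top m).preimage continuous_toPrimeSpectrum

theorem isOpen_finrank_fiber_eq (M : Type*) [AddCommGroup M] [Module R M] [Module.Finite R M]
    [Module.Projective R M] (n : ℕ) :
    IsOpen[harrisonTopology R]
      {α : RealSpectrum R | Module.finrank α.residueField (α.residueField ⊗[R] M) = n} := by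
  let _ := harrisonTopology R
  have := Module.finitePresentation_of_projective R M
  have h := ((Module.isLocallyConstant_rankAtStalk (R := R) (M := M)).isOpen_fiber n).preimage
    (continuous_toPrimeSpectrum (R := R))
  convert h using 1
  ext α
  have := Ideal.finrank_fiber_eq_rankAtStalk (M := M) α.supp
  exact ⟨fun h => this.symm.trans h, fun h => this.trans h⟩

/-! ### The positive and negative index along the real spectrum -/

variable {M : Type*} [Invertible (2 : R)] [AddCommGroup M] [Module R M]

/-- The quadratic form `q ⊗ κ(α)`, whose signature is `q.signAt α`. -/
noncomputable abbrev fiberForm (q : QuadraticForm R M) (α : RealSpectrum R) :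
    QuadraticForm α.residueField (α.residueField ⊗[R] M) :=
  q.baseChange α.residueField

theorem fiberForm_one_tmul (q : QuadraticForm R M) (α : RealSpectrum R) (m : M) :
    fiberForm q α (1 ⊗ₜ m) = algebraMap R α.residueField (q m) := by
  simp [Algebra.smul_def]

theorem fiberForm_neg (q : QuadraticForm R M) (α : RealSpectrum R) :
    fiberForm (-q) α = -fiberForm q α :=
  QuadraticForm.baseChange_neg _ q

theorem sigPos_fiberForm_eq_ncard (q : QuadraticForm R M) (α : RealSpectrum R) {ι : Type*}
    [Fintype ι] (m : ι → M) (v : Module.Basis ι α.residueField (α.residueField ⊗[R] M))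
    (hv : ∀ i, v i = 1 ⊗ₜ m i)
    (hm : ∀ i j, i ≠ j → QuadraticMap.associated (R := R) q (m i) (m j) ∈ α.supp) :
    sigPos (fiberForm q α) = {i | α ∈ harrisonSet (q (m i))}.ncard := by
  let _ : Invertible (2 : α.residueField) := invertibleOfNonzero two_ne_zero
  have hv' : (QuadraticMap.associated (R := α.residueField) (fiberForm q α)).IsOrthoᵢ v := by
    intro i j hij
    have h := Ideal.algebraMap_residueField_eq_zero.2 (hm i j hij)
    simp only [Function.onFun]
    rw [hv, hv, QuadraticForm.associated_baseChange_tmul, Algebra.smul_def, h, zero_mul]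
  rw [QuadraticForm.sigPos_of_equiv_weightedSumSquares
    (QuadraticForm.equivalent_weightedSumSquares_of_basis _ v hv')]
  simp only [hv, fiberForm_one_tmul, algebraMap_pos_iff]

theorem sigNeg_fiberForm_eq_ncard (q : QuadraticForm R M) (α : RealSpectrum R) {ι : Type*}
    [Fintype ι] (m : ι → M) (v : Module.Basis ι α.residueField (α.residueField ⊗[R] M))
    (hv : ∀ i, v i = 1 ⊗ₜ m i)
    (hm : ∀ i j, i ≠ j → QuadraticMap.associated (R := R) q (m i) (m j) ∈ α.supp) :
    sigNeg (fiberForm q α) = {i | α ∈ harrisonSet (-q (m i))}.ncard := by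
  simpa only [fiberForm_neg, sigPos_neg, neg_apply] using sigPos_fiberForm_eq_ncard (-q) α m v hv
    fun i j hij => by simpa using hm i j hij

variable [Module.Finite R M]

/-- The positive index is lower semicontinuous for the Harrison topology. -/
theorem isOpen_le_sigPos (q : QuadraticForm R M) (k : ℕ) :
    IsOpen[harrisonTopology R] {α : RealSpectrum R | k ≤ sigPos (fiberForm q α)} := by
  let _ := harrisonTopology R
  rw [isOpen_iff_mem_nhds]
  intro α hα
  obtain ⟨m, v, hv, hm⟩ := q.exists_basis_one_tmul_orthogonal α.supp
  set P := {i | α ∈ harrisonSet (q (m i))} with hP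
  rw [Set.mem_ofPred_eq, sigPos_fiberForm_eq_ncard q α m v hv hm, ← hP] at hα
  have : Fintype P := Fintype.ofFinite P
  -- The strict inequalities `|b i j| < q (m i)` hold at `α`, where `b i j` vanishes for `i ≠ j`, and
  -- say that `q (m i) - b i j` and `q (m i) + b i j` are positive.
  let b (i j : P) : R := Fintype.card P * QuadraticMap.associated (R := R) q (m i) (m j)
  have hmem : ∀ (i j : P) (r : R), i ≠ j → (r = b i j ∨ r = -b i j) →
      harrisonSet (q (m i) - r) ∈ 𝓝 α := by
    intro i j r hij hr
    refine (isOpen_harrisonSet _).mem_nhds ?_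
    have hb : algebraMap R α.residueField (b i j) = 0 := by
      simp only [b, map_mul]
      rw [Ideal.algebraMap_residueField_eq_zero.2 (hm i j fun h => hij (Subtype.ext h)), mul_zero]
    rw [← algebraMap_pos_iff, map_sub]
    have hi := (algebraMap_pos_iff α _).2 i.2
    rcases hr with rfl | rfl <;> simpa [hb] using hi
  have h1 : ∀ᶠ β in 𝓝 α, ∀ i : P, β ∈ harrisonSet (q (m i)) :=
    Filter.eventually_all.2 fun i => (isOpen_harrisonSet _).mem_nhds i.2
  have h2 : ∀ᶠ β in 𝓝 α, ∀ i j : P, i ≠ j →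
      β ∈ harrisonSet (q (m i) - b i j) ∧ β ∈ harrisonSet (q (m i) - -b i j) := by
    refine Filter.eventually_all.2 fun i => Filter.eventually_all.2 fun j => ?_
    by_cases hij : i = j
    · exact Filter.Eventually.of_forall fun _ h => absurd hij h
    · filter_upwards [hmem i j _ hij (.inl rfl), hmem i j _ hij (.inr rfl)] with β h h' _
      exact ⟨h, h'⟩
  filter_upwards [h1, h2] with β hβ1 hβ2
  let _ : Invertible (2 : β.residueField) := invertibleOfNonzero two_ne_zero
  rw [← Nat.card_coe_set_eq, Nat.card_eq_fintype_card] at hα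
  refine hα.trans (QuadraticForm.card_le_sigPos_of_diagonally_dominant _
    (fun i : P => (1 : β.residueField) ⊗ₜ[R] m i) (fun i => ?_) fun i j hij => ?_)
  · rw [fiberForm_one_tmul, algebraMap_pos_iff]
    exact hβ1 i
  · obtain ⟨h3, h4⟩ := hβ2 i j hij
    rw [← algebraMap_pos_iff, map_sub, sub_pos] at h3 h4
    rw [map_neg] at h4
    rw [fiberForm_one_tmul, QuadraticForm.associated_baseChange_tmul, Algebra.smul_def, mul_one,
      mul_one, ← Nat.abs_cast, ← abs_mul, abs_lt]
    simp only [b, map_mul, map_natCast] at h3 h4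
    exact ⟨by linarith, h3⟩

theorem isOpen_le_sigNeg (q : QuadraticForm R M) (k : ℕ) :
    IsOpen[harrisonTopology R] {α : RealSpectrum R | k ≤ sigNeg (fiberForm q α)} := by
  simpa only [fiberForm_neg, sigPos_neg] using isOpen_le_sigPos (-q) k

/-! ### Continuity of the total signature -/

variable [Module.Projective R M]

theorem continuous_signAt_harrison (q : QuadraticForm R M) (hq : q.IsNonsingular) :
    Continuous[harrisonTopology R, (inferInstance : TopologicalSpace ℤ)]
      (fun α : RealSpectrum R => q.signAt α) := by
  let _ := harrisonTopology R
  refine (IsLocallyConstant.iff_eventually_eq _).2 (fun α => ?_) |>.continuous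
  filter_upwards [(isOpen_le_sigPos q (sigPos (fiberForm q α))).mem_nhds (le_refl (α := ℕ) _),
    (isOpen_le_sigNeg q (sigNeg (fiberForm q α))).mem_nhds (le_refl (α := ℕ) _),
    (isOpen_finrank_fiber_eq M _).mem_nhds (x := α) rfl] with β h1 h2 h3
  have hsum : ∀ γ : RealSpectrum R, sigPos (fiberForm q γ) + sigNeg (fiberForm q γ) =
      Module.finrank γ.residueField (γ.residueField ⊗[R] M) := fun γ => by
    rw [← QuadraticForm.sigPos_add_sigNeg_add_radical (Q := fiberForm q γ),
      hq.radical_baseChange γ.residueField, finrank_bot, add_zero]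
  have hα := hsum α
  have hβ := hsum β
  change (sigPos (fiberForm q β) : ℤ) - sigNeg (fiberForm q β) =
    sigPos (fiberForm q α) - sigNeg (fiberForm q α)
  -- Both indices can only grow near `α`, while their sum stays the same.
  omega

theorem continuous_signAt_constructible (q : QuadraticForm R M) :
    Continuous[constructibleTopology R, (inferInstance : TopologicalSpace ℤ)]
      (fun α : RealSpectrum R => q.signAt α) := by
  let _ := constructibleTopology R
  have hle : ∀ {s : Set (RealSpectrum R)}, IsOpen[harrisonTopology R] s → IsOpen s :=
    fun h => constructibleTopology_le_harrisonTopology _ h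
  refine (IsLocallyConstant.iff_eventually_eq _).2 (fun α => ?_) |>.continuous
  obtain ⟨m, v, hv, hm⟩ := q.exists_basis_one_tmul_orthogonal α.supp
  have hsign : ∀ r : R, ∀ᶠ β in 𝓝 α, (β ∈ harrisonSet r ↔ α ∈ harrisonSet r) := by
    intro r
    by_cases hr : α ∈ harrisonSet r
    · filter_upwards [(hle (isOpen_harrisonSet r)).mem_nhds hr] with β hβ
      exact iff_of_true hβ hr
    · filter_upwards [(isOpen_constructibleTopology_compl_harrisonSet r).mem_nhds hr] with β hβ
      exact iff_of_false hβ hr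
  have hspan := (hle (isOpen_span_one_tmul_eq_top m)).mem_nhds (x := α) (by
      have := v.span_eq
      rwa [funext hv] at this)
  filter_upwards [hspan, (hle (isOpen_finrank_fiber_eq M _)).mem_nhds (x := α) rfl,
    Filter.eventually_all.2 fun i => hsign (q (m i)),
    Filter.eventually_all.2 fun i => hsign (-q (m i)),
    Filter.eventually_all.2 fun i => Filter.eventually_all.2 fun j =>
      hsign (QuadraticMap.associated (R := R) q (m i) (m j)),
    Filter.eventually_all.2 fun i => Filter.eventually_all.2 fun j =>
      hsign (-QuadraticMap.associated (R := R) q (m i) (m j))] with β h1 h2 h3 h4 h5 h6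
  have hmβ : ∀ i j, i ≠ j → QuadraticMap.associated (R := R) q (m i) (m j) ∈ β.supp := by
    intro i j hij
    have := hm i j hij
    rw [← Ideal.algebraMap_residueField_eq_zero, algebraMap_eq_zero_iff] at this ⊢
    rwa [h5, h6]
  -- A spanning family with as many members as the dimension is a basis.
  let w := basisOfTopLeSpanOfCardEqFinrank (fun i => (1 : β.residueField) ⊗ₜ[R] m i)
    (top_le_iff.2 h1)
    (by rw [Fintype.card_fin]; exact h2.symm)
  have hw : ∀ i, w i = 1 ⊗ₜ m i := fun i => by simp [w]
  change (sigPos (fiberForm q β) : ℤ) - sigNeg (fiberForm q β) =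
    sigPos (fiberForm q α) - sigNeg (fiberForm q α)
  rw [sigPos_fiberForm_eq_ncard q β m w hw hmβ, sigNeg_fiberForm_eq_ncard q β m w hw hmβ,
    sigPos_fiberForm_eq_ncard q α m v hv hm, sigNeg_fiberForm_eq_ncard q α m v hv hm]
  simp only [h3, h4]

end RealSpectrum

theorem mainTheorem12 {R M : Type*} [CommRing R] [Invertible (2 : R)]
    [AddCommGroup M] [Module R M] [Module.Finite R M] [Module.Projective R M]
    (q : QuadraticForm R M) :
    Continuous[RealSpectrum.constructibleTopology R, (inferInstance : TopologicalSpace ℤ)]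
        (fun α : RealSpectrum R => q.signAt α) ∧
      (q.IsNonsingular →
        Continuous[RealSpectrum.harrisonTopology R, (inferInstance : TopologicalSpace ℤ)]
          (fun α : RealSpectrum R => q.signAt α)) :=
  ⟨RealSpectrum.continuous_signAt_constructible q, RealSpectrum.continuous_signAt_harrison q⟩
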